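/- Let $\mathfrak{D}$ be an infinite alphabet. For $m\ge 1$ let $\mathcal{R}^+_m$ be the set of all words over $\mathfrak{D}$ of the form $$c_0\,(c_1u_1c_1)\,(c_2u_2c_2)\cdots(c_{m-1}u_{m-1}c_{m-1})\,c_m ,$$ where $c_0,\dots,c_m\in\mathfrak{D}$, $u_1,\dots,u_{m-1}\in\mathfrak{D}^*$, $c_i$ does not occur in $u_i$ for $1\le i\le m-1$, and $c_i\ne c_{i+1}$ for $0\le i\le m-1$. A weak $k$-pebble automaton (weak $k$-PA, $k\ge1$) is a tuple $\langle Q,q_0,F,\mu,U\rangle$ with a finite set $Q$ of states, an initial state $q_0\in Q$, final states $F\subseteq Q$, universal states $U\subseteq Q\setminus F$, and a finite set $\mu$ of transitions $(i,P,V,q)\to(p,\mathtt{act})$ with $1\le i\le k$, $P,V\subseteq\{i+1,\dots,k\}$, $q,p\in Q$ and $\mathtt{act}\in\{\mathtt{right},\mathtt{place\text{-}pebble},\mathtt{lift\text{-}pebble}\}$. On an input $w=a_1\cdots a_n$, a configuration is a triple $[i,q,\theta]$ with $1\le i\le k$, $q\in Q$ and $\theta:\{i,\dots,k\}\to\{0,\dots,n+1\}$;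 positions $0$ and $n+1$ carry the end markers $a_0=\triangleleft$ and $a_{n+1}=\triangleright$, two distinct symbols not in $\mathfrak{D}$. The transition $(i,P,V,q)\to(p,\mathtt{act})$ applies to $[i,q,\theta]$ if $P=\{l>i:\theta(l)=\theta(i)\}$ and $V=\{l>i: a_{\theta(l)}=a_{\theta(i)}\}$; it then leads to the configuration with state $p$ in which pebble $i$ has moved one position to the right ($\mathtt{right}$), or pebble $i$ is removed and $i+1$ is the head pebble ($\mathtt{lift\text{-}pebble}$), or pebble $i-1$ is placed at position $\theta(i)$ and is the head pebble ($\mathtt{place\text{-}pebble}$), all other pebbles being unchanged, provided that this is a configuration. A configuration leads to acceptance if its state is in $F$, or its state is in $U$ and all its successors lead to acceptance, or its state is in neither and some successor leads to acceptance (least such predicate). The automaton accepts $w$ if the initial configuration $[k,q_0,\theta_0]$, $\theta_0(k)=0$, leads to acceptance. Then $\mathcal{R}^+_k$ is accepted by some weak $k$-PA for every $k\ge 2$, and $\mathcal{R}^+_{k+1}$ is not accepted by any weak $k$-PA for every $k\ge 1$. -/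

import Mathlib

/-- A cell of the input tape `◁ w ▷` over the alphabet `D`: an end marker or a letter. -/
inductive TapeSymbol (D : Type*) where
  | leftEnd : TapeSymbol D
  | rightEnd : TapeSymbol D
  | letter (a : D) : TapeSymbol D

/-- The symbol at position `p` of `◁ w ▷`. Position `0` carries the left-end marker, positions
`1, …, n` the letters of `w` (`n = w.length`), position `n + 1` the right-end marker. (Positions
beyond `n + 1` never occur in a run.) -/
def tapeAt {D : Type*} (w : List D) : ℕ → TapeSymbol D
  | 0 => TapeSymbol.leftEnd
  | p + 1 =>
    match w[p]? with
    | some a => TapeSymbol.letter a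
    | none => TapeSymbol.rightEnd

/-- The actions of a weak pebble automaton; the head only moves to the right. -/
inductive PebbleAction where
  | right : PebbleAction
  | placePebble : PebbleAction
  | liftPebble : PebbleAction

/-- A transition `(i, P, V, q) → (p, act)`, where `i = pebble`, `q = source`, `p = target`. -/
structure PebbleTransition (Q : Type) where
  pebble : ℕ
  P : Finset ℕ
  V : Finset ℕ
  source : Q
  target : Q
  act : PebbleAction

/-- A (one-way, alternating) weak `k`-pebble automaton `⟨Q, q₀, F, μ, U⟩`, with pebbles
`1, …, k`. The set `trans` of transitions is finite by `trans_wf`, because `State` is finite. -/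
structure WeakPA (k : ℕ) where
  /-- the finite set `Q` of states -/
  State : Type
  finite_state : Finite State
  /-- the initial state `q₀` -/
  init : State
  /-- the final states `F` -/
  final : Set State
  /-- the universal states `U ⊆ Q \ F` -/
  univ : Set State
  univ_subset : univ ⊆ finalᶜ
  /-- the transitions `μ`; in `(i, P, V, q)` one has `1 ≤ i ≤ k` and `P, V ⊆ {i + 1, …, k}` -/
  trans : Set (PebbleTransition State)
  trans_wf : ∀ t ∈ trans,
    1 ≤ t.pebble ∧ t.pebble ≤ k ∧ t.P ⊆ Finset.Ioc t.pebble k ∧ t.V ⊆ Finset.Ioc t.pebble k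

/-- A configuration `[i, q, θ]`: `i = head` is the head pebble, `q = state`, and the pebble
assignment `θ : {i, …, k} → {0, …, n + 1}` is the restriction of `pos` to `{i, …, k}`. The values
of `pos` at pebbles that are not placed are never read. -/
structure PebbleConfig (Q : Type) where
  head : ℕ
  state : Q
  pos : ℕ → ℕ

namespace WeakPA

variable {D : Type*} {k : ℕ}

/-- The transition `t` applies to the configuration `c` on `◁ w ▷`: the head pebble and the state
are those of `t`, `t.P` is the set of the pebbles `l > i` at the position of the head pebble `i`,
and `t.V` the set of the pebbles `l > i` that read the same symbol as the head pebble. -/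
def Applies (A : WeakPA k) (w : List D) (t : PebbleTransition A.State)
    (c : PebbleConfig A.State) : Prop :=
  t.pebble = c.head ∧ t.source = c.state ∧
  (∀ l, l ∈ t.P ↔ c.head < l ∧ l ≤ k ∧ c.pos l = c.pos c.head) ∧
  (∀ l, l ∈ t.V ↔ c.head < l ∧ l ≤ k ∧ tapeAt w (c.pos l) = tapeAt w (c.pos c.head))

/-- One step `c ⊢ c'` on `◁ w ▷`. The result has to be a configuration again: the head pebble
cannot leave the tape to the right of `▷`, pebble `k` cannot be lifted, and no pebble can be
placed below pebble `1`. A new pebble is placed at the position of the head pebble. -/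
inductive Step (A : WeakPA k) (w : List D) :
    PebbleConfig A.State → PebbleConfig A.State → Prop
  | right (c : PebbleConfig A.State) (t : PebbleTransition A.State) (ht : t ∈ A.trans)
      (happ : A.Applies w t c) (hact : t.act = PebbleAction.right)
      (hpos : c.pos c.head + 1 ≤ w.length + 1) :
      Step A w c ⟨c.head, t.target, Function.update c.pos c.head (c.pos c.head + 1)⟩
  | lift (c : PebbleConfig A.State) (t : PebbleTransition A.State) (ht : t ∈ A.trans)
      (happ : A.Applies w t c) (hact : t.act = PebbleAction.liftPebble)
      (hhead : c.head + 1 ≤ k) :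
      Step A w c ⟨c.head + 1, t.target, c.pos⟩
  | place (c : PebbleConfig A.State) (t : PebbleTransition A.State) (ht : t ∈ A.trans)
      (happ : A.Applies w t c) (hact : t.act = PebbleAction.placePebble)
      (hhead : 1 ≤ c.head - 1) :
      Step A w c ⟨c.head - 1, t.target, Function.update c.pos (c.head - 1) (c.pos c.head)⟩

/-- A configuration leads to acceptance if its state is final, or its state is universal and all
its successors lead to acceptance, or its state is neither and some successor leads to acceptance
(least fixed point of these clauses). -/
inductive LeadsToAcceptance (A : WeakPA k) (w : List D) : PebbleConfig A.State → Prop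
  | final (c : PebbleConfig A.State) (hF : c.state ∈ A.final) : LeadsToAcceptance A w c
  | universal (c : PebbleConfig A.State) (hU : c.state ∈ A.univ)
      (hall : ∀ c', A.Step w c c' → LeadsToAcceptance A w c') : LeadsToAcceptance A w c
  | existential (c c' : PebbleConfig A.State) (hF : c.state ∉ A.final) (hU : c.state ∉ A.univ)
      (hstep : A.Step w c c') (hacc : LeadsToAcceptance A w c') : LeadsToAcceptance A w c

/-- The initial configuration `[k, q₀, θ₀]`: only pebble `k` is placed, at position `0`. -/
def initConfig (A : WeakPA k) : PebbleConfig A.State := ⟨k, A.init, fun _ => 0⟩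

/-- The language over the alphabet `D` that is accepted by `A`. -/
def language (A : WeakPA k) (D : Type*) : Language D :=
  {w : List D | A.LeadsToAcceptance w A.initConfig}

end WeakPA

/-- `wPA D k`: the languages over `D` that are accepted by a weak `k`-pebble automaton. -/
def wPA (D : Type*) (k : ℕ) : Set (Language D) :=
  {L | ∃ A : WeakPA k, A.language D = L}

/-- The language `R⁺ₘ` (for `m ≥ 1`) of all words
`c₀ (c₁ u₁ c₁) (c₂ u₂ c₂) ⋯ (cₘ₋₁ uₘ₋₁ cₘ₋₁) cₘ` where `uᵢ` does not contain `cᵢ`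
(`1 ≤ i ≤ m - 1`), and `cᵢ ≠ cᵢ₊₁` (`0 ≤ i ≤ m - 1`). -/
def reachPlus (D : Type*) (m : ℕ) : Language D :=
  {w : List D | ∃ (c : ℕ → D) (u : ℕ → List D),
    (∀ i, 1 ≤ i → i < m → c i ∉ u i) ∧
    (∀ i, i < m → c i ≠ c (i + 1)) ∧
    w = [c 0] ++ (List.Ico 1 m).flatMap (fun i => [c i] ++ u i ++ [c i]) ++ [c m]}

/-!
A word `c₀ c₁ v` is in `reachPlus D (m + 1)` when `m` jumps, each from a letter to its next
occurrence and one step further, lead from `c₁` to the last letter (`HopPath`,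
`mem_reachPlus_iff`). The jumps are deterministic, so pebbles `k, …, 1`, each one dropped where the
next jump starts and remembering the letter there, can follow `k - 1` jumps: pebble `j` searches
for the letter under pebble `j + 1`. The end of the word is recognized by a universal state whose
only transition moves right, since at the right-end marker that state has no successor
(`ReachState.language_reachAutomaton`).

With `k` pebbles one cannot follow `k` jumps. Take letters `a r x` for layers `r ≤ k + 1` and
indices `x < N`, and the word `pathWord a N k s t`, in which the start `a 1 s` is followed by
regions `r = 1, …, k - 1` listing the pairs `a r x, a (r + 1) x` for all `x`, and then by
`a k t, a (k + 1) 0`. The jumps from `a 1 s` lead to `a 2 s, …, a k s`, so the word is in the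
language if and only if `s = t` (`pathWord_mem_iff`). Give pebble `l` the start of region
`k - l + 1` as its threshold, region `k` being the last two letters. A pebble above `l` which has
not passed its own threshold reads a letter of layer at most `k - l`, and this does not occur
after the threshold of pebble `l` (`hidden_pathWord`). Two facts follow. As long as no pebble has
passed its threshold, the letter `a k t` is not read. And when pebble `l` is the first to pass, the
outcome of the computation until it is lifted is that of a solo computation of the pebbles
`1, …, l`, a function of the state and of the accepting exit states which depends only on the
suffix, hence on `t` but not on `s`. So these functions are all the information on `t` that
is available (`WeakPA.leadsToAcceptance_transfer`). Their number is bounded independently of `N`,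
and the pigeonhole principle gives `t ≠ t'` such that acceptance of `pathWord a N k t t` entails
acceptance of `pathWord a N k t t'`.
-/

/-! ### Paths of jumps -/

/-- `HopPath m v`: starting at the first letter of `v`, one can `m` times jump from the current
letter `c` to its next occurrence and step on to the following letter, which has to differ from
`c`, and one then stands on the last letter of `v`. The language `reachPlus D (m + 1)` consists of
the words `c₀ v` with `HopPath m v` in which `v` does not start with `c₀`. -/
inductive HopPath {D : Type*} : ℕ → List D → Prop
  | single (c : D) : HopPath 0 [c]
  | hop {m : ℕ} {c c' : D} {u v : List D} (hu : c ∉ u) (hne : c ≠ c') (h : HopPath m (c' :: v)) :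
      HopPath (m + 1) (c :: (u ++ c :: c' :: v))

namespace HopPath

variable {D : Type*} {m : ℕ} {c d : D} {u v : List D}

theorem not_nil : ¬ HopPath m ([] : List D) := by
  intro h
  cases h

theorem zero_iff : HopPath 0 v ↔ ∃ c, v = [c] := by
  constructor
  · intro h
    cases h
    exact ⟨_, rfl⟩
  · rintro ⟨c, rfl⟩
    exact single c

theorem succ_iff : HopPath (m + 1) (c :: v) ↔
    ∃ (c' : D) (u v' : List D), c ∉ u ∧ c ≠ c' ∧ HopPath m (c' :: v') ∧ v = u ++ c :: c' :: v' := by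
  constructor
  · intro h
    cases h with
    | hop hu hne h => exact ⟨_, _, _, hu, hne, h, rfl⟩
  · rintro ⟨c', u, v', hu, hne, h, rfl⟩
    exact hop hu hne h

theorem mem_of_succ (h : HopPath (m + 1) (c :: v)) : c ∈ v := by
  obtain ⟨c', u, v', -, -, -, rfl⟩ := succ_iff.1 h
  simp

theorem cons_ne_iff (hd : d ≠ c) : HopPath (m + 1) (c :: d :: v) ↔ HopPath (m + 1) (c :: v) := by
  rw [succ_iff, succ_iff]
  constructor
  · rintro ⟨c', u, v', hu, hne, h, hv⟩
    cases u with
    | nil => simp_all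
    | cons x u =>
      simp only [List.cons_append, List.cons.injEq] at hv
      exact ⟨c', u, v', fun hc => hu (List.mem_cons_of_mem _ hc), hne, h, hv.2⟩
  · rintro ⟨c', u, v', hu, hne, h, rfl⟩
    exact ⟨c', d :: u, v', by simp [hu, hd.symm], hne, h, rfl⟩

theorem append_iff (hu : c ∉ u) : HopPath (m + 1) (c :: (u ++ v)) ↔ HopPath (m + 1) (c :: v) := by
  induction u with
  | nil => rfl
  | cons d u ih =>
    simp only [List.mem_cons, not_or] at hu
    rw [List.cons_append, cons_ne_iff (Ne.symm hu.1), ih hu.2]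

theorem cons_self_iff : HopPath (m + 1) (c :: c :: v) ↔
    ∃ (c' : D) (v' : List D), v = c' :: v' ∧ c ≠ c' ∧ HopPath m (c' :: v') := by
  rw [succ_iff]
  constructor
  · rintro ⟨c', u, v', hu, hne, h, hv⟩
    cases u with
    | nil =>
      simp only [List.nil_append, List.cons.injEq, true_and] at hv
      exact ⟨c', v', hv, hne, h⟩
    | cons x u => simp_all
  · rintro ⟨c', v', rfl, hne, h⟩
    exact ⟨c', [], v', by simp, hne, h, rfl⟩

theorem iff_exists_seq : HopPath m v ↔ ∃ (c : ℕ → D) (u : ℕ → List D),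
    (∀ i, i < m → c i ∉ u i) ∧ (∀ i, i < m → c i ≠ c (i + 1)) ∧
    v = (List.range m).flatMap (fun i => [c i] ++ u i ++ [c i]) ++ [c m] := by
  constructor
  · intro h
    induction h with
    | single c => exact ⟨fun _ => c, fun _ => [], by simp, by simp, by simp⟩
    | @hop m c₀ c' u₀ v hu hne h ih =>
      obtain ⟨c, u, h1, h2, h3⟩ := ih
      have hc0 : c 0 = c' := by
        cases m <;> simp [List.range_succ_eq_map] at h3 <;> simp_all
      refine ⟨fun i => i.casesOn c₀ c, fun i => i.casesOn u₀ u, ?_, ?_, ?_⟩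
      · rintro (_ | i) hi
        · exact hu
        · exact h1 i (by omega)
      · rintro (_ | i) hi
        · simpa [hc0] using hne
        · exact h2 i (by omega)
      · simp [List.range_succ_eq_map, h3, List.flatMap_map]
  · rintro ⟨c, u, h1, h2, rfl⟩
    induction m generalizing c u with
    | zero => exact single _
    | succ m ih =>
      have h := ih (fun i => c (i + 1)) (fun i => u (i + 1)) (fun i hi => h1 _ (by omega))
        (fun i hi => h2 _ (by omega))
      have hw : ∃ v', (List.range m).flatMap
          (fun i => [c (i + 1)] ++ u (i + 1) ++ [c (i + 1)]) ++ [c (m + 1)] = c 1 :: v' := by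
        cases m <;> simp [List.range_succ_eq_map]
      obtain ⟨v', hv'⟩ := hw
      simp only [hv'] at h
      have := hop (h1 0 (by omega)) (h2 0 (by omega)) h
      rw [← hv'] at this
      simpa [List.range_succ_eq_map, List.flatMap_map] using this

end HopPath

theorem mem_reachPlus_iff {D : Type*} {m : ℕ} {w : List D} : w ∈ reachPlus D (m + 1) ↔
    ∃ (c₀ c₁ : D) (v : List D), w = c₀ :: c₁ :: v ∧ c₀ ≠ c₁ ∧ HopPath m (c₁ :: v) := by
  have hIco : List.Ico 1 (m + 1) = (List.range m).map (· + 1) := by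
    simp [List.Ico, List.range'_eq_map_range, Nat.add_comm]
  constructor
  · rintro ⟨c, u, h1, h2, rfl⟩
    have h : HopPath m ((List.range m).flatMap
        (fun i => [c (i + 1)] ++ u (i + 1) ++ [c (i + 1)]) ++ [c (m + 1)]) :=
      HopPath.iff_exists_seq.2 ⟨fun i => c (i + 1), fun i => u (i + 1),
        fun i hi => h1 _ (by omega) (by omega), fun i hi => h2 _ (by omega), rfl⟩
    have hw : ∃ v', (List.range m).flatMap
        (fun i => [c (i + 1)] ++ u (i + 1) ++ [c (i + 1)]) ++ [c (m + 1)] = c 1 :: v' := by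
      cases m <;> simp [List.range_succ_eq_map]
    obtain ⟨v', hv'⟩ := hw
    rw [hv'] at h
    refine ⟨c 0, c 1, v', ?_, h2 0 (by omega), h⟩
    rw [← hv', hIco]
    simp [List.flatMap_map]
  · rintro ⟨c₀, c₁, v, rfl, hne, h⟩
    obtain ⟨c, u, h1, h2, h3⟩ := HopPath.iff_exists_seq.1 h
    have hc0 : c 0 = c₁ := by
      cases m <;> simp [List.range_succ_eq_map] at h3 <;> simp_all
    refine ⟨fun i => i.casesOn c₀ c, fun i => i.casesOn [] u, ?_, ?_, ?_⟩
    · rintro (_ | i) hi hi'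
      · omega
      · exact h1 i (by omega)
    · rintro (_ | i) hi
      · simpa [hc0] using hne
      · exact h2 i (by omega)
    · rw [h3, hIco]
      simp [List.flatMap_map]

/-! ### The automaton for `reachPlus` -/

theorem tapeAt_of_drop_eq_cons {D : Type*} {w v : List D} {r : ℕ} {d : D}
    (h : w.drop r = d :: v) : tapeAt w (r + 1) = TapeSymbol.letter d := by
  have : w[r]? = some d := by
    have := List.getElem?_drop (xs := w) (i := r) (j := 0)
    simpa [h] using this.symm
  simp [tapeAt, this]

theorem tapeAt_of_drop_eq_nil {D : Type*} {w : List D} {r : ℕ}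
    (h : w.drop r = []) : tapeAt w (r + 1) = TapeSymbol.rightEnd := by
  have : w[r]? = none := by
    simpa using h
  simp [tapeAt, this]

/-- The states of the automaton for `reachPlus D k`. In `start`, …, `jump` pebble `k`, with the
help of pebble `k - 1`, checks that the first two letters differ and moves on to the second letter.
In the remaining states the head pebble `j` starts at the position of pebble `j + 1` (`leave`),
moves to the next occurrence of the letter under pebble `j + 1` (`search`), and one step further
(`next`), where the next pebble is placed, or, if `j = 1`, the end of the word has to follow. -/
inductive ReachState where
  | start | first | depart | compare | back | jump | leave | search | next | last | dead

namespace ReachState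

theorem finite : Finite ReachState := by
  have : Set.Finite (Set.univ : Set ReachState) :=
    Set.Finite.subset (Set.toFinite
      ({start, first, depart, compare, back, jump, leave, search, next, last, dead}))
      (fun x _ => by cases x <;> simp)
  exact Set.finite_univ_iff.1 this

/-- The deterministic transition rule for head pebble `i`; `seen` tells whether pebble `i` reads
the same symbol as pebble `i + 1`. -/
def rule (i : ℕ) (seen : Bool) : ReachState → Option (ReachState × PebbleAction)
  | start => some (first, .right)
  | first => some (depart, .placePebble)
  | depart => some (compare, .right)
  | compare => if seen then none else some (back, .liftPebble)
  | back => some (jump, .right)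
  | jump => some (leave, .placePebble)
  | leave => some (search, .right)
  | search => if seen then some (next, .right) else some (search, .right)
  | next => if seen then none else if i = 1 then some (last, .right) else some (leave, .placePebble)
  | last => some (dead, .right)
  | dead => none

end ReachState

open ReachState in
/-- The weak `k`-pebble automaton for `reachPlus D k`. Its only universal state is `last`; having
a single transition, which moves right into a dead state, it accepts exactly at the right-end
marker, where that transition is blocked. -/
abbrev reachAutomaton (k : ℕ) : WeakPA k where
  State := ReachState
  finite_state := ReachState.finite
  init := start
  final := ∅
  univ := {last}
  univ_subset := by simp
  trans := {t | (1 ≤ t.pebble ∧ t.pebble ≤ k ∧ t.P ⊆ Finset.Ioc t.pebble k ∧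
    t.V ⊆ Finset.Ioc t.pebble k) ∧
    rule t.pebble (decide (t.pebble + 1 ∈ t.V)) t.source = some (t.target, t.act)}
  trans_wf := fun _ ht => ht.1

namespace WeakPA

/-- The configuration `c'` results from `c` by the action `act` into the state `q`, and is
again a configuration. -/
inductive Moves {Q : Type} (k n : ℕ) (c : PebbleConfig Q) (q : Q) :
    PebbleAction → PebbleConfig Q → Prop
  | right (h : c.pos c.head + 1 ≤ n + 1) :
      Moves k n c q .right ⟨c.head, q, Function.update c.pos c.head (c.pos c.head + 1)⟩
  | lift (h : c.head + 1 ≤ k) : Moves k n c q .liftPebble ⟨c.head + 1, q, c.pos⟩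
  | place (h : 1 ≤ c.head - 1) : Moves k n c q .placePebble
      ⟨c.head - 1, q, Function.update c.pos (c.head - 1) (c.pos c.head)⟩

theorem step_iff_moves {D : Type*} {k : ℕ} {A : WeakPA k} {w : List D}
    {c c' : PebbleConfig A.State} :
    A.Step w c c' ↔ ∃ t ∈ A.trans, A.Applies w t c ∧ Moves k w.length c t.target t.act c' := by
  constructor
  · intro h
    cases h with
    | right t ht happ hact hpos => exact ⟨t, ht, happ, hact ▸ .right hpos⟩
    | lift t ht happ hact hpos => exact ⟨t, ht, happ, hact ▸ .lift hpos⟩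
    | place t ht happ hact hpos => exact ⟨t, ht, happ, hact ▸ .place hpos⟩
  · rintro ⟨t, ht, happ, hm⟩
    generalize hact : t.act = a at hm
    cases hm with
    | right h => exact .right c t ht happ hact h
    | lift h => exact .lift c t ht happ hact h
    | place h => exact .place c t ht happ hact h

theorem leadsToAcceptance_iff {D : Type*} {k : ℕ} {A : WeakPA k} {w : List D}
    {c : PebbleConfig A.State} (hF : c.state ∉ A.final) (hU : c.state ∉ A.univ) :
    A.LeadsToAcceptance w c ↔ ∃ c', A.Step w c c' ∧ A.LeadsToAcceptance w c' := by
  constructor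
  · intro h
    cases h with
    | final _ h => exact absurd h hF
    | universal _ h => exact absurd h hU
    | existential _ c' _ _ h h' => exact ⟨c', h, h'⟩
  · rintro ⟨c', h, h'⟩
    exact .existential _ c' hF hU h h'

end WeakPA

namespace ReachState

open WeakPA

variable {D : Type*} {k : ℕ} {w : List D}

open Classical in
theorem step_iff {c c' : PebbleConfig ReachState} (h1 : 1 ≤ c.head) (hk : c.head ≤ k) :
    (reachAutomaton k).Step w c c' ↔ ∃ q act,
      rule c.head (decide (c.head < k ∧ tapeAt w (c.pos (c.head + 1)) = tapeAt w (c.pos c.head)))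
        c.state = some (q, act) ∧ Moves k w.length c q act c' := by
  rw [step_iff_moves]
  constructor
  · rintro ⟨t, ⟨-, hr⟩, ⟨hp, hs, -, hV⟩, hm⟩
    refine ⟨_, _, ?_, hm⟩
    rw [hp, hs] at hr
    rw [← hr]
    congr 2
    rw [hV]
    apply propext
    constructor
    · rintro ⟨h, h'⟩
      exact ⟨by omega, by omega, h'⟩
    · rintro ⟨-, h, h'⟩
      exact ⟨by omega, h'⟩
  · rintro ⟨q, act, hr, hm⟩
    refine ⟨⟨c.head, (Finset.Ioc c.head k).filter (fun l => c.pos l = c.pos c.head),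
      (Finset.Ioc c.head k).filter (fun l => tapeAt w (c.pos l) = tapeAt w (c.pos c.head)),
      c.state, q, act⟩, ⟨⟨h1, hk, Finset.filter_subset _ _, Finset.filter_subset _ _⟩, ?_⟩,
      ⟨rfl, rfl, by simp [and_assoc], by simp [and_assoc]⟩, hm⟩
    rw [← hr]
    congr 2
    simp

theorem accepts_iff {c : PebbleConfig ReachState} (hs : c.state ≠ last) :
    (reachAutomaton k).LeadsToAcceptance w c ↔
      ∃ c', (reachAutomaton k).Step w c c' ∧ (reachAutomaton k).LeadsToAcceptance w c' :=
  leadsToAcceptance_iff (A := reachAutomaton k) (Set.notMem_empty _) hs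

open Classical in
theorem accepts_iff_right {i : ℕ} {s q : ReachState} {θ : ℕ → ℕ} (h1 : 1 ≤ i) (hk : i ≤ k)
    (hr : rule i (decide (i < k ∧ tapeAt w (θ (i + 1)) = tapeAt w (θ i))) s = some (q, .right))
    (hs : s ≠ last) :
    (reachAutomaton k).LeadsToAcceptance w ⟨i, s, θ⟩ ↔ θ i ≤ w.length ∧
      (reachAutomaton k).LeadsToAcceptance w ⟨i, q, Function.update θ i (θ i + 1)⟩ := by
  rw [accepts_iff hs]
  constructor
  · rintro ⟨c', hstep, hc'⟩
    obtain ⟨q', act, hr', hm⟩ := (step_iff (c := ⟨i, s, θ⟩) h1 hk).1 hstep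
    simp only [hr, Option.some.injEq, Prod.mk.injEq] at hr'
    obtain ⟨rfl, rfl⟩ := hr'
    cases hm with
    | right h => exact ⟨by simpa using h, hc'⟩
  · rintro ⟨h, h'⟩
    exact ⟨_, (step_iff (c := ⟨i, s, θ⟩) h1 hk).2 ⟨_, _, hr, .right (by simpa using h)⟩, h'⟩

open Classical in
theorem accepts_iff_place {i : ℕ} {s q : ReachState} {θ : ℕ → ℕ} (h1 : 1 ≤ i) (hk : i + 1 ≤ k)
    (hr : rule (i + 1) (decide (i + 1 < k ∧ tapeAt w (θ (i + 1 + 1)) = tapeAt w (θ (i + 1)))) s =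
      some (q, .placePebble)) (hs : s ≠ last) :
    (reachAutomaton k).LeadsToAcceptance w ⟨i + 1, s, θ⟩ ↔
      (reachAutomaton k).LeadsToAcceptance w ⟨i, q, Function.update θ i (θ (i + 1))⟩ := by
  rw [accepts_iff hs]
  constructor
  · rintro ⟨c', hstep, hc'⟩
    obtain ⟨q', act, hr', hm⟩ := (step_iff (c := ⟨i + 1, s, θ⟩) (by simp) hk).1 hstep
    simp only [hr, Option.some.injEq, Prod.mk.injEq] at hr'
    obtain ⟨rfl, rfl⟩ := hr'
    cases hm with
    | place h => exact hc'
  · intro h'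
    exact ⟨_, (step_iff (c := ⟨i + 1, s, θ⟩) (by simp) hk).2 ⟨_, _, hr, .place (by simpa using h1)⟩,
      h'⟩

open Classical in
theorem accepts_iff_lift {i : ℕ} {s q : ReachState} {θ : ℕ → ℕ} (h1 : 1 ≤ i) (hk : i + 1 ≤ k)
    (hr : rule i (decide (i < k ∧ tapeAt w (θ (i + 1)) = tapeAt w (θ i))) s =
      some (q, .liftPebble)) (hs : s ≠ last) :
    (reachAutomaton k).LeadsToAcceptance w ⟨i, s, θ⟩ ↔
      (reachAutomaton k).LeadsToAcceptance w ⟨i + 1, q, θ⟩ := by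
  rw [accepts_iff hs]
  constructor
  · rintro ⟨c', hstep, hc'⟩
    obtain ⟨q', act, hr', hm⟩ := (step_iff (c := ⟨i, s, θ⟩) h1 (by simp; omega)).1 hstep
    simp only [hr, Option.some.injEq, Prod.mk.injEq] at hr'
    obtain ⟨rfl, rfl⟩ := hr'
    cases hm with
    | lift h => exact hc'
  · intro h'
    exact ⟨_, (step_iff (c := ⟨i, s, θ⟩) h1 (by simp; omega)).2 ⟨_, _, hr, .lift hk⟩, h'⟩

open Classical in
theorem not_accepts {i : ℕ} {s : ReachState} {θ : ℕ → ℕ} (h1 : 1 ≤ i) (hk : i ≤ k)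
    (hr : rule i (decide (i < k ∧ tapeAt w (θ (i + 1)) = tapeAt w (θ i))) s = none)
    (hs : s ≠ last) : ¬ (reachAutomaton k).LeadsToAcceptance w ⟨i, s, θ⟩ := by
  rw [accepts_iff hs]
  rintro ⟨c', hstep, hc'⟩
  obtain ⟨q', act, hr', hm⟩ := (step_iff (c := ⟨i, s, θ⟩) h1 hk).1 hstep
  rw [hr] at hr'
  cases hr'

theorem accepts_last_iff {i : ℕ} {θ : ℕ → ℕ} (h1 : 1 ≤ i) (hk : i ≤ k) :
    (reachAutomaton k).LeadsToAcceptance w ⟨i, last, θ⟩ ↔ w.length < θ i := by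
  constructor
  · intro h
    by_contra hlt
    have hstep := (step_iff (k := k) (w := w) (c := ⟨i, last, θ⟩) h1 hk).2
      ⟨_, _, rfl, .right (by simpa using hlt)⟩
    cases h with
    | final _ h => exact absurd h (Set.notMem_empty _)
    | universal _ _ h => exact not_accepts h1 hk rfl (by simp) (h _ hstep)
    | existential _ c' _ h => exact h rfl
  · intro h
    refine .universal _ rfl fun c' hstep => ?_
    obtain ⟨q', act, hr', hm⟩ := (step_iff (c := ⟨i, last, θ⟩) h1 hk).1 hstep
    simp only [rule, Option.some.injEq, Prod.mk.injEq] at hr'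
    obtain ⟨rfl, rfl⟩ := hr'
    cases hm with
    | right h' => simp at h'; omega

/-- In state `next`, with `leave` one pebble further down analysed, the remaining input has to
start with a letter other than the one under pebble `j + 1`, and to be a path from there. -/
theorem accepts_next_iff {j r : ℕ} {θ : ℕ → ℕ} {c : D} (hj : j + 1 < k)
    (hleave : 1 ≤ j → ∀ (θ : ℕ → ℕ) (r : ℕ), θ (j + 1) = r + 1 → θ j = r + 1 → r ≤ w.length →
      ((reachAutomaton k).LeadsToAcceptance w ⟨j, leave, θ⟩ ↔ HopPath j (w.drop r)))
    (hc : tapeAt w (θ (j + 1 + 1)) = .letter c) (hθ : θ (j + 1) = r + 1) (hr : r ≤ w.length) :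
    (reachAutomaton k).LeadsToAcceptance w ⟨j + 1, next, θ⟩ ↔
      ∃ (c' : D) (v' : List D), w.drop r = c' :: v' ∧ c ≠ c' ∧ HopPath j (c' :: v') := by
  by_cases hseen : tapeAt w (θ (j + 1)) = .letter c
  · refine iff_of_false (not_accepts (by omega) hj.le ?_ (by simp)) ?_
    · simp [rule, hj, hc, hseen]
    · rintro ⟨c', v', hv, hne, -⟩
      rw [hθ, tapeAt_of_drop_eq_cons hv] at hseen
      exact hne (TapeSymbol.letter.inj hseen).symm
  · have hdrop : ∀ c' v', w.drop r = c' :: v' → c ≠ c' := by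
      rintro c' v' hv rfl
      exact hseen (by rw [hθ, tapeAt_of_drop_eq_cons hv])
    rcases Nat.eq_zero_or_pos j with rfl | hj0
    · rw [accepts_iff_right (q := last) (by omega) hj.le
        (by simp [rule, hj, hc, Ne.symm hseen]) (by simp),
        accepts_last_iff (by omega) hj.le]
      simp only [HopPath.zero_iff, Function.update_self]
      constructor
      · rintro ⟨h, h'⟩
        have hlen : (w.drop r).length = 1 := by
          rw [List.length_drop]
          omega
        obtain ⟨c', hc'⟩ := List.length_eq_one_iff.1 hlen
        exact ⟨c', [], hc', hdrop _ _ hc', c', rfl⟩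
      · rintro ⟨c', v', hv, -, d, hd⟩
        have hlen : (w.drop r).length = 1 := by
          rw [hv, hd]
          rfl
        rw [List.length_drop] at hlen
        omega
    · rw [accepts_iff_place (q := leave) hj0 hj.le
        (by simp [rule, hj, hc, Ne.symm hseen]; omega) (by simp),
        hleave hj0 _ r (by simp [hθ]) (by simp [hθ]) hr]
      constructor
      · intro h
        cases hv : w.drop r with
        | nil => exact absurd (hv ▸ h) HopPath.not_nil
        | cons c' v' => exact ⟨c', v', rfl, hdrop _ _ hv, hv ▸ h⟩
      · rintro ⟨c', v', hv, -, h⟩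
        rwa [hv]

theorem accepts_search_iff {j r : ℕ} {θ : ℕ → ℕ} {c : D} (hj : j + 1 < k)
    (hleave : 1 ≤ j → ∀ (θ : ℕ → ℕ) (r : ℕ), θ (j + 1) = r + 1 → θ j = r + 1 → r ≤ w.length →
      ((reachAutomaton k).LeadsToAcceptance w ⟨j, leave, θ⟩ ↔ HopPath j (w.drop r)))
    (hc : tapeAt w (θ (j + 1 + 1)) = .letter c) (hθ : θ (j + 1) = r + 1) (hr : r ≤ w.length) :
    (reachAutomaton k).LeadsToAcceptance w ⟨j + 1, search, θ⟩ ↔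
      HopPath (j + 1) (c :: w.drop r) := by
  generalize hv : w.drop r = v
  induction v generalizing r θ with
  | nil =>
    have htape := tapeAt_of_drop_eq_nil hv
    have hr' : ¬ r + 1 ≤ w.length := by
      simpa using hv
    refine iff_of_false ?_ fun h => by simpa using h.mem_of_succ
    rw [accepts_iff_right (q := search) (by omega) hj.le (by simp [rule, hc, hθ, htape])
      (by simp), hθ]
    exact fun h => hr' h.1
  | cons d v ih =>
    have htape := tapeAt_of_drop_eq_cons hv
    have hr' : r + 1 ≤ w.length := by
      by_contra h
      rw [List.drop_eq_nil_of_le (by omega)] at hv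
      simp at hv
    have hv' : w.drop (r + 1) = v := by
      rw [← List.tail_drop, hv, List.tail_cons]
    by_cases hd : d = c
    · subst hd
      rw [accepts_iff_right (q := next) (by omega) hj.le (by simp [rule, hj, hc, hθ, htape])
        (by simp), accepts_next_iff (c := d) (r := r + 1) hj hleave (by simpa using hc)
        (by simp [hθ]) hr', HopPath.cons_self_iff, hv', hθ]
      exact and_iff_right hr'
    · rw [accepts_iff_right (q := search) (by omega) hj.le
        (by simp [rule, hc, hθ, htape, Ne.symm hd]) (by simp),
        ih (r := r + 1) (by simpa using hc) (by simp [hθ]) hr' hv', HopPath.cons_ne_iff hd, hθ]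
      exact and_iff_right hr'

theorem accepts_leave_iff {j r : ℕ} {θ : ℕ → ℕ} (hj1 : 1 ≤ j) (hj : j < k)
    (hθ' : θ (j + 1) = r + 1) (hθ : θ j = r + 1) (hr : r ≤ w.length) :
    (reachAutomaton k).LeadsToAcceptance w ⟨j, leave, θ⟩ ↔ HopPath j (w.drop r) := by
  induction j generalizing r θ with
  | zero => omega
  | succ j ih =>
    rw [accepts_iff_right (q := search) (by omega) hj.le rfl (by simp), hθ]
    cases hv : w.drop r with
    | nil =>
      have hr' : ¬ r + 1 ≤ w.length := by
        simpa using hv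
      exact iff_of_false (fun h => hr' h.1) HopPath.not_nil
    | cons c v =>
      have hr' : r + 1 ≤ w.length := by
        by_contra h
        rw [List.drop_eq_nil_of_le (by omega)] at hv
        simp at hv
      have hv' : w.drop (r + 1) = v := by
        rw [← List.tail_drop, hv, List.tail_cons]
      rw [accepts_search_iff (c := c) (r := r + 1) hj
        (fun h1 θ r h2 h3 h4 => ih h1 (by omega) h2 h3 h4)
        (by simp [hθ', tapeAt_of_drop_eq_cons hv]) (by simp) hr', hv']
      exact and_iff_right hr'

theorem language_reachAutomaton {k : ℕ} (hk : 2 ≤ k) :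
    (reachAutomaton k).language D = reachPlus D k := by
  obtain ⟨j, rfl⟩ : ∃ j, k = j + 1 + 1 := ⟨k - 2, by omega⟩
  ext w
  rw [mem_reachPlus_iff]
  change (reachAutomaton (j + 1 + 1)).LeadsToAcceptance w ⟨j + 1 + 1, start, fun _ => 0⟩ ↔ _
  rw [accepts_iff_right (q := first) (by omega) le_rfl rfl (by simp),
    accepts_iff_place (q := depart) (by omega) le_rfl rfl (by simp),
    accepts_iff_right (q := compare) (by omega) (by omega) rfl (by simp)]
  match w with
  | [] =>
    simp
  | [c₀] =>
    simp only [List.length_cons]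
    rw [accepts_iff_lift (q := back) (by omega) le_rfl (by simp [rule, tapeAt]) (by simp),
      accepts_iff_right (q := jump) (by omega) le_rfl rfl (by simp),
      accepts_iff_place (q := leave) (by omega) le_rfl rfl (by simp),
      accepts_leave_iff (r := 1) (by omega) (by omega) (by simp) (by simp) (by simp)]
    simp [HopPath.not_nil]
  | c₀ :: c₁ :: v =>
    by_cases h01 : c₀ = c₁
    · subst h01
      refine iff_of_false ?_ (by simp)
      rintro ⟨-, -, h⟩
      exact not_accepts (by omega) (by omega) (by simp [rule, tapeAt]) (by simp) h
    · simp only [List.length_cons]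
      rw [accepts_iff_lift (q := back) (by omega) le_rfl (by simp [rule, tapeAt, h01]) (by simp),
        accepts_iff_right (q := jump) (by omega) le_rfl rfl (by simp),
        accepts_iff_place (q := leave) (by omega) le_rfl rfl (by simp),
        accepts_leave_iff (r := 1) (by omega) (by omega) (by simp) (by simp) (by simp)]
      simp [h01]

end ReachState

/-! ### Pebbles passing their thresholds -/

namespace WeakPA

variable {D : Type*} {k : ℕ}

/-- Acceptance of the computation of the pebbles `1, …, l` alone: as `LeadsToAcceptance`, but once
pebble `l` is lifted, the configuration counts as accepting if and only if its state lies in `S`. -/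
inductive AcceptsUntil (A : WeakPA k) (w : List D) (l : ℕ) (S : Set A.State) :
    PebbleConfig A.State → Prop
  | exit (c : PebbleConfig A.State) (hl : l < c.head) (hS : c.state ∈ S) : AcceptsUntil A w l S c
  | final (c : PebbleConfig A.State) (hl : c.head ≤ l) (hF : c.state ∈ A.final) :
      AcceptsUntil A w l S c
  | universal (c : PebbleConfig A.State) (hl : c.head ≤ l) (hU : c.state ∈ A.univ)
      (hall : ∀ c', A.Step w c c' → AcceptsUntil A w l S c') : AcceptsUntil A w l S c
  | existential (c c' : PebbleConfig A.State) (hl : c.head ≤ l) (hF : c.state ∉ A.final)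
      (hU : c.state ∉ A.univ) (hstep : A.Step w c c') (hacc : AcceptsUntil A w l S c') :
      AcceptsUntil A w l S c

theorem Moves.head_le {Q : Type} {n : ℕ} {c c' : PebbleConfig Q} {q : Q} {act : PebbleAction}
    (h : Moves k n c q act c') (hc : c.head ≤ k) : c'.head ≤ k := by
  cases h with
  | right h => exact hc
  | lift h => exact h
  | place h => exact (Nat.sub_le _ _).trans hc

theorem Step.head_le {A : WeakPA k} {w : List D} {c c' : PebbleConfig A.State}
    (h : A.Step w c c') (hc : c.head ≤ k) : c'.head ≤ k := by
  obtain ⟨t, -, -, hm⟩ := step_iff_moves.1 h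
  exact hm.head_le hc

/-- A position `p` left of `b` whose symbol does not occur at or after position `b`: a pebble
there is invisible to a pebble at or after `b`. -/
def Hidden (w : List D) (b p : ℕ) : Prop :=
  p < b ∧ ∀ q, b ≤ q → tapeAt w p ≠ tapeAt w q

/-- Two configurations, on the tapes of `w` and `w'`, which agree on the placed pebbles up to `l`,
all at or after position `b`, and in which all pebbles above `l` are hidden from `b` on. -/
structure Tied {Q : Type} (k l b : ℕ) (w w' : List D) (c c' : PebbleConfig Q) : Prop where
  head : c'.head = c.head
  state : c'.state = c.state
  low : ∀ j, c.head ≤ j → j ≤ l → c'.pos j = c.pos j ∧ b ≤ c.pos j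
  high : ∀ j, l < j → j ≤ k → Hidden w b (c.pos j) ∧ Hidden w' b (c'.pos j)

theorem Tied.symm {Q : Type} {l b : ℕ} {w w' : List D} {c c' : PebbleConfig Q}
    (h : Tied k l b w w' c c') : Tied k l b w' w c' c where
  head := h.head.symm
  state := h.state.symm
  low j hj hl := by
    obtain ⟨h1, h2⟩ := h.low j (h.head ▸ hj) hl
    exact ⟨h1.symm, h1 ▸ h2⟩
  high j hj hk := (h.high j hj hk).symm

theorem Tied.step {A : WeakPA k} {l b : ℕ} {w w' : List D} {c c' d : PebbleConfig A.State}
    (hlen : w'.length = w.length) (htape : ∀ q, b ≤ q → tapeAt w' q = tapeAt w q)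
    (h : Tied k l b w w' c c') (hl : c.head ≤ l) (hstep : A.Step w c d) :
    ∃ d', A.Step w' c' d' ∧ Tied k l b w w' d d' := by
  obtain ⟨i, q, θ⟩ := c
  obtain ⟨i', q', θ'⟩ := c'
  obtain ⟨h1, h2, low, high⟩ := h
  simp only at h1 h2 low high hl
  subst h1 h2
  obtain ⟨hi, hbi⟩ := low i' le_rfl hl
  obtain ⟨t, ht, ⟨hp, hs, hP, hV⟩, hm⟩ := step_iff_moves.1 hstep
  have happ : A.Applies w' t ⟨i', q', θ'⟩ := by
    refine ⟨hp, hs, fun j => (hP j).trans ?_, fun j => (hV j).trans ?_⟩ <;>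
      refine and_congr_right fun hij => and_congr_right fun hjk => ?_ <;>
      simp only at hij ⊢ <;> rcases le_or_gt j l with hjl | hjl
    · rw [(low j hij.le hjl).1, hi]
    · have h1 := (high j hjl hjk).1.1
      have h2 := (high j hjl hjk).2.1
      omega
    · rw [(low j hij.le hjl).1, hi, htape _ hbi, htape _ (low j hij.le hjl).2]
    · exact iff_of_false ((high j hjl hjk).1.2 _ hbi) ((high j hjl hjk).2.2 _ (hi ▸ hbi))
  have key : ∀ d', Moves k w'.length ⟨i', q', θ'⟩ t.target t.act d' →
      Tied k l b w w' d d' → ∃ d', A.Step w' ⟨i', q', θ'⟩ d' ∧ Tied k l b w w' d d' :=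
    fun d' hm' ht' => ⟨d', step_iff_moves.2 ⟨t, ht, happ, hm'⟩, ht'⟩
  generalize t.act = act at hm key
  cases hm with
  | right h =>
    refine key _ (.right (by simpa [hlen, hi] using h)) ⟨rfl, rfl, fun j hj hjl => ?_,
      fun j hj hjk => ?_⟩
    · simp only at hj ⊢
      obtain ⟨h1, h2⟩ := low j hj hjl
      by_cases hji : j = i'
      · subst hji
        simp only [Function.update_self]
        omega
      · simp [hji, h1, h2]
    · simp only
      rw [Function.update_of_ne (by omega), Function.update_of_ne (by omega)]
      exact high j hj hjk
  | lift h =>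
    exact key _ (.lift h) ⟨rfl, rfl, fun j hj hjl => low j (Nat.le_of_succ_le hj) hjl, high⟩
  | place h =>
    refine key _ (.place h) ⟨rfl, rfl, fun j hj hjl => ?_, fun j hj hjk => ?_⟩
    · simp only at hj ⊢
      by_cases hji : j = i' - 1
      · subst hji
        simp [hi, hbi]
      · simp only [Function.update_of_ne hji]
        exact low j (by omega) hjl
    · simp only
      rw [Function.update_of_ne (by omega), Function.update_of_ne (by omega)]
      exact high j hj hjk

theorem Tied.acceptsUntil {A : WeakPA k} {l b : ℕ} {S : Set A.State} {w w' : List D}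
    {c c' : PebbleConfig A.State} (hlen : w'.length = w.length)
    (htape : ∀ q, b ≤ q → tapeAt w' q = tapeAt w q) (h : Tied k l b w w' c c')
    (hacc : A.AcceptsUntil w l S c) : A.AcceptsUntil w' l S c' := by
  induction hacc generalizing c' with
  | exit c hl hS => exact .exit _ (h.head ▸ hl) (h.state ▸ hS)
  | final c hl hF => exact .final _ (h.head ▸ hl) (h.state ▸ hF)
  | universal c hl hU hall ih =>
    refine .universal _ (h.head ▸ hl) (h.state ▸ hU) fun d' hd' => ?_
    obtain ⟨d, hd, htied⟩ := h.symm.step hlen.symm (fun q hq => (htape q hq).symm) (h.head ▸ hl) hd'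
    exact ih d hd htied.symm
  | existential c d hl hF hU hstep hacc ih =>
    obtain ⟨d', hd', htied⟩ := h.step hlen htape hl hstep
    exact .existential _ d' (h.head ▸ hl) (h.state ▸ hF) (h.state ▸ hU) hd' (ih htied)

/-- Acceptance does not depend on the values of `θ` at pebbles that are not placed. -/
theorem LeadsToAcceptance.congr_pos {A : WeakPA k} {w : List D} {i : ℕ} {q : A.State}
    {θ θ' : ℕ → ℕ} (hi : i ≤ k) (hθ : ∀ j, i ≤ j → θ' j = θ j)
    (h : A.LeadsToAcceptance w ⟨i, q, θ⟩) : A.LeadsToAcceptance w ⟨i, q, θ'⟩ := by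
  suffices key : ∀ c, A.LeadsToAcceptance w c → c.head ≤ k →
      ∀ c', Tied k k 0 w w c c' → A.LeadsToAcceptance w c' from
    key _ h hi _ ⟨rfl, rfl, fun j hj _ => ⟨hθ j hj, Nat.zero_le _⟩, fun j h1 h2 => by omega⟩
  intro c hc
  induction hc with
  | final c hF => exact fun _ c' htied => .final _ (htied.state ▸ hF)
  | universal c hU hall ih =>
    refine fun hk c' htied => .universal _ (htied.state ▸ hU) fun d' hd' => ?_
    obtain ⟨d, hd, htied'⟩ := htied.symm.step rfl (fun _ _ => rfl) (htied.head ▸ hk) hd'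
    exact ih d hd (hd.head_le hk) _ htied'.symm
  | existential c d hF hU hstep hacc ih =>
    intro hk c' htied
    obtain ⟨d', hd', htied'⟩ := htied.step rfl (fun _ _ => rfl) hk hstep
    exact .existential _ d' (htied.state ▸ hF) (htied.state ▸ hU) hd'
      (ih (hstep.head_le hk) _ htied')

theorem Step.pos_eq {A : WeakPA k} {w : List D} {c d : PebbleConfig A.State}
    (h : A.Step w c d) {j : ℕ} (hj : c.head < j) : d.pos j = c.pos j := by
  obtain ⟨t, -, -, hm⟩ := step_iff_moves.1 h
  generalize t.act = act at hm
  cases hm with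
  | right h => exact Function.update_of_ne (by omega) _ _
  | lift h => rfl
  | place h => exact Function.update_of_ne (by omega) _ _

theorem Step.head_le_succ {A : WeakPA k} {w : List D} {c d : PebbleConfig A.State}
    (h : A.Step w c d) : d.head ≤ c.head + 1 := by
  obtain ⟨t, -, -, hm⟩ := step_iff_moves.1 h
  generalize t.act = act at hm
  cases hm with
  | right h => simp
  | lift h => simp
  | place h => simp only; omega

theorem AcceptsUntil.leadsToAcceptance {A : WeakPA k} {w : List D} {l : ℕ} {θ : ℕ → ℕ}
    {c : PebbleConfig A.State}
    (h : A.AcceptsUntil w l {q | A.LeadsToAcceptance w ⟨l + 1, q, θ⟩} c)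
    (hk : c.head ≤ k) (hl : c.head ≤ l + 1) (hθ : ∀ j, l < j → c.pos j = θ j) :
    A.LeadsToAcceptance w c := by
  induction h with
  | exit c h hS =>
    obtain ⟨i, q, θ'⟩ := c
    obtain rfl : i = l + 1 := le_antisymm hl h
    exact LeadsToAcceptance.congr_pos hk (fun j hj => hθ j hj) hS
  | final c _ hF => exact .final _ hF
  | universal c h hU hall ih =>
    refine .universal _ hU fun d hd => ih d hd (hd.head_le hk)
      (hd.head_le_succ.trans (by omega)) fun j hj => ?_
    rw [hd.pos_eq (by omega), hθ j hj]
  | existential c d h hF hU hd hacc ih =>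
    refine .existential _ d hF hU hd (ih (hd.head_le hk)
      (hd.head_le_succ.trans (by omega)) fun j hj => ?_)
    rw [hd.pos_eq (by omega), hθ j hj]

theorem Step.congr_tape {A : WeakPA k} {w w' : List D} {c d : PebbleConfig A.State}
    (hlen : w.length = w'.length) (hk : c.head ≤ k)
    (htape : ∀ j, c.head ≤ j → j ≤ k → tapeAt w (c.pos j) = tapeAt w' (c.pos j))
    (h : A.Step w c d) : A.Step w' c d := by
  obtain ⟨t, ht, ⟨hp, hs, hP, hV⟩, hm⟩ := step_iff_moves.1 h
  refine step_iff_moves.2 ⟨t, ht, ⟨hp, hs, hP, fun j => (hV j).trans ?_⟩, hlen ▸ hm⟩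
  refine and_congr_right fun hij => and_congr_right fun hjk => ?_
  rw [htape j hij.le hjk, htape _ le_rfl hk]

/-- All placed pebbles `j` are left of their thresholds `B j`. -/
def InTime {Q : Type} (k : ℕ) (B : ℕ → ℕ) (c : PebbleConfig Q) : Prop :=
  1 ≤ c.head ∧ c.head ≤ k ∧ ∀ j, c.head ≤ j → j ≤ k → c.pos j < B j

/-- Pebble `l` has passed its threshold `B l`, while the pebbles above `l` are left of theirs;
the placed pebbles below `l` are, like pebble `l`, at or after position `B l`. -/
def Ahead {Q : Type} (k : ℕ) (B : ℕ → ℕ) (l : ℕ) (c : PebbleConfig Q) : Prop :=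
  1 ≤ c.head ∧ c.head ≤ l ∧ l ≤ k ∧ (∀ j, l < j → j ≤ k → c.pos j < B j) ∧
    ∀ j, c.head ≤ j → j ≤ l → B l ≤ c.pos j

theorem InTime.step {A : WeakPA k} {w : List D} {B : ℕ → ℕ} {c d : PebbleConfig A.State}
    (hB : ∀ l, 1 ≤ l → l < k → B (l + 1) ≤ B l) (hc : InTime k B c) (hstep : A.Step w c d) :
    InTime k B d ∨ Ahead k B d.head d := by
  obtain ⟨i, q, θ⟩ := c
  obtain ⟨h1, hk, hpos⟩ := hc
  obtain ⟨t, -, -, hm⟩ := step_iff_moves.1 hstep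
  generalize t.act = act at hm
  simp only at h1 hk hpos
  cases hm with
  | right h =>
    simp only
    have hother : ∀ j, i < j → j ≤ k → Function.update θ i (θ i + 1) j < B j := fun j hj hjk => by
      rw [Function.update_of_ne (by omega)]
      exact hpos j hj.le hjk
    by_cases hi : θ i + 1 < B i
    · refine .inl ⟨h1, hk, fun j hj hjk => ?_⟩
      rcases eq_or_lt_of_le hj with rfl | hj
      · simpa using hi
      · exact hother j hj hjk
    · refine .inr ⟨h1, le_rfl, hk, hother, fun j hj hji => ?_⟩
      obtain rfl := le_antisymm hj hji
      simpa using hi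
  | lift h => exact .inl ⟨by simp, h, fun j hj hjk => hpos j (by simp at hj; omega) hjk⟩
  | place h =>
    refine .inl ⟨h, by simp only; omega, fun j hj hjk => ?_⟩
    simp only at hj h ⊢
    by_cases hji : j = i - 1
    · subst hji
      have h2 := hB (i - 1) h (by omega)
      rw [Nat.sub_add_cancel h1] at h2
      simpa using (hpos i le_rfl hk).trans_le h2
    · rw [Function.update_of_ne hji]
      exact hpos j (by omega) hjk

theorem Ahead.step {A : WeakPA k} {w : List D} {B : ℕ → ℕ} {l : ℕ} {c d : PebbleConfig A.State}
    (hc : Ahead k B l c) (hstep : A.Step w c d) :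
    Ahead k B l d ∨ (d.head = l + 1 ∧ InTime k B d) := by
  obtain ⟨i, q, θ⟩ := c
  obtain ⟨h1, hil, hlk, hhigh, hlow⟩ := hc
  obtain ⟨t, -, -, hm⟩ := step_iff_moves.1 hstep
  generalize t.act = act at hm
  simp only at h1 hil hhigh hlow
  cases hm with
  | right h =>
    refine .inl ⟨h1, hil, hlk, fun j hj hjk => ?_, fun j hj hjl => ?_⟩
    · simp only
      rw [Function.update_of_ne (by omega)]
      exact hhigh j hj hjk
    · simp only at hj ⊢
      have := hlow j hj hjl
      by_cases hji : j = i
      · subst hji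
        simp only [Function.update_self]
        omega
      · rwa [Function.update_of_ne hji]
  | lift h =>
    rcases eq_or_lt_of_le hil with rfl | hil
    · exact .inr ⟨rfl, by simp, h, fun j hj hjk => hhigh j hj hjk⟩
    · exact .inl ⟨by simp, hil, hlk, hhigh, fun j hj hjl => hlow j (by simp at hj; omega) hjl⟩
  | place h =>
    refine .inl ⟨h, by simp only; omega, hlk, fun j hj hjk => ?_, fun j hj hjl => ?_⟩
    · simp only
      rw [Function.update_of_ne (by omega)]
      exact hhigh j hj hjk
    · simp only at hj h ⊢
      by_cases hji : j = i - 1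
      · subst hji
        simpa using hlow i le_rfl hil
      · rw [Function.update_of_ne hji]
        exact hlow j (by omega) hjl

/-- The configuration with head pebble `l` at position `b` and all pebbles above at position `0`,
where they see the left-end marker and hence are hidden. -/
def soloConfig {Q : Type} (l b : ℕ) (q : Q) : PebbleConfig Q :=
  ⟨l, q, fun j => if j ≤ l then b else 0⟩

theorem tapeAt_ne_leftEnd {w : List D} {p : ℕ} (hp : 0 < p) :
    TapeSymbol.leftEnd ≠ tapeAt w p := by
  obtain ⟨p, rfl⟩ := Nat.exists_eq_succ_of_ne_zero hp.ne'
  simp only [tapeAt]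
  split <;> simp

theorem hidden_zero {w : List D} {b : ℕ} (hb : 0 < b) : Hidden w b 0 :=
  ⟨hb, fun _ hq => tapeAt_ne_leftEnd (hb.trans_le hq)⟩

theorem tied_soloConfig {A : WeakPA k} {w : List D} {l b : ℕ} {q : A.State} {θ : ℕ → ℕ}
    (hb : 0 < b) (hθ : θ l = b) (hhid : ∀ j, l < j → j ≤ k → Hidden w b (θ j)) :
    Tied k l b w w ⟨l, q, θ⟩ (soloConfig l b q) where
  head := rfl
  state := rfl
  low j hj hjl := by
    obtain rfl := le_antisymm hj hjl
    simp [soloConfig, hθ]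
  high j hj hjk := ⟨hhid j hj hjk, by simpa [soloConfig, hj.not_ge] using hidden_zero hb⟩

/-- The transfer principle behind the lower bound. Every pebble `l` has a threshold `B l`, and
the tape left of `B l'` shares no symbol with the tape from `B l` on if `l < l'`. Hence,
when pebble `l` is the first one to pass its threshold, no other pebble is visible to it, and the
outcome up to the lifting of pebble `l` is that of `soloConfig l (B l) q`. If `w` and `w'` agree
left of `B 1` and cannot be distinguished by the solo computations, then they cannot be
distinguished at all. -/
theorem leadsToAcceptance_transfer {A : WeakPA k} {w w' : List D} {B : ℕ → ℕ}
    (hlen : w.length = w'.length) (hpos : ∀ l, 0 < B l)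
    (hanti : ∀ l l', l ≤ l' → B l' ≤ B l)
    (htape : ∀ p, p < B 1 → tapeAt w p = tapeAt w' p)
    (hhid : ∀ l l' p, 1 ≤ l → l < l' → l' ≤ k → p < B l' → Hidden w (B l) p)
    (hhid' : ∀ l l' p, 1 ≤ l → l < l' → l' ≤ k → p < B l' → Hidden w' (B l) p)
    (hsolo : ∀ l, 1 ≤ l → l ≤ k → ∀ S q, A.AcceptsUntil w l S (soloConfig l (B l) q) →
      A.AcceptsUntil w' l S (soloConfig l (B l) q))
    {c : PebbleConfig A.State} (hc : InTime k B c) (h : A.LeadsToAcceptance w c) :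
    A.LeadsToAcceptance w' c := by
  have hagree : ∀ c : PebbleConfig A.State, InTime k B c → ∀ j, c.head ≤ j → j ≤ k →
      tapeAt w (c.pos j) = tapeAt w' (c.pos j) := fun c hc j hj hjk =>
    htape _ ((hc.2.2 j hj hjk).trans_le (hanti 1 j (hc.1.trans hj)))
  have hstep : ∀ c d : PebbleConfig A.State, InTime k B c → A.Step w c d →
      InTime k B d ∨ (Ahead k B d.head d ∧ d.pos d.head = B d.head) := by
    intro c d hc hd
    refine (hc.step (fun l _ _ => hanti _ _ (Nat.le_succ l)) hd).imp_right fun had => ⟨had, ?_⟩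
    obtain ⟨t, -, -, hm⟩ := step_iff_moves.1 hd
    generalize t.act = act at hm
    have h1 := had.2.2.2.2 d.head le_rfl le_rfl
    have h2 := hc.2.2 c.head le_rfl hc.2.1
    cases hm with
    | right h =>
      simp only [Function.update_self] at h1 ⊢
      omega
    | lift h =>
      have := hc.2.2 (c.head + 1) (by omega) h
      simp only at h1
      omega
    | place h =>
      have := hanti (c.head - 1) c.head (by omega)
      simp only [Function.update_self] at h1
      omega
  -- A pebble stepping onto its threshold starts a solo computation.
  have hcross : ∀ d : PebbleConfig A.State, Ahead k B d.head d → d.pos d.head = B d.head →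
      A.AcceptsUntil w d.head {q | A.LeadsToAcceptance w' ⟨d.head + 1, q, d.pos⟩} d →
      A.LeadsToAcceptance w' d := by
    intro d had hd hacc
    obtain ⟨l, q, θ⟩ := d
    obtain ⟨h1, -, hlk, hhigh, -⟩ := had
    simp only at h1 hlk hhigh hd hacc
    have hacc1 := (tied_soloConfig (hpos l) hd fun j hj hjk =>
      hhid l j _ h1 hj hjk (hhigh j hj hjk)).acceptsUntil rfl (fun _ _ => rfl) hacc
    have hacc2 := (tied_soloConfig (hpos l) hd fun j hj hjk =>
      hhid' l j _ h1 hj hjk (hhigh j hj hjk)).symm.acceptsUntil rfl (fun _ _ => rfl)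
      (hsolo l h1 hlk _ q hacc1)
    exact hacc2.leadsToAcceptance hlk (Nat.le_succ l) fun _ _ => rfl
  have hnext : ∀ c d : PebbleConfig A.State, InTime k B c → A.Step w c d →
      ((InTime k B d → A.LeadsToAcceptance w' d) ∧ ∀ l θ, Ahead k B l d →
        (∀ j, l < j → θ j = d.pos j) →
        A.AcceptsUntil w l {q | A.LeadsToAcceptance w' ⟨l + 1, q, θ⟩} d) →
      A.LeadsToAcceptance w' d := by
    intro c d hc hd ih
    rcases hstep c d hc hd with hin | ⟨had, hdB⟩
    · exact ih.1 hin
    · exact hcross d had hdB (ih.2 _ _ had fun _ _ => rfl)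
  have hahead : ∀ (c d : PebbleConfig A.State) (l : ℕ) (θ : ℕ → ℕ), Ahead k B l c →
      (∀ j, l < j → θ j = c.pos j) → A.Step w c d →
      ((InTime k B d → A.LeadsToAcceptance w' d) ∧ ∀ l θ, Ahead k B l d →
        (∀ j, l < j → θ j = d.pos j) →
        A.AcceptsUntil w l {q | A.LeadsToAcceptance w' ⟨l + 1, q, θ⟩} d) →
      A.AcceptsUntil w l {q | A.LeadsToAcceptance w' ⟨l + 1, q, θ⟩} d := by
    intro c d l θ hc hθ hd ih
    have hθ' : ∀ j, l < j → θ j = d.pos j := fun j hj => by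
      rw [hd.pos_eq (hc.2.1.trans_lt hj), hθ j hj]
    rcases hc.step hd with had | ⟨hhead, hin⟩
    · exact ih.2 l θ had hθ'
    · obtain ⟨i, q, θ''⟩ := d
      simp only at hhead
      subst hhead
      exact .exit _ (Nat.lt_succ_self l)
        (LeadsToAcceptance.congr_pos hin.2.1 (fun j hj => hθ' j hj) (ih.1 hin))
  suffices key : (InTime k B c → A.LeadsToAcceptance w' c) ∧ ∀ l θ, Ahead k B l c →
      (∀ j, l < j → θ j = c.pos j) →
      A.AcceptsUntil w l {q | A.LeadsToAcceptance w' ⟨l + 1, q, θ⟩} c from key.1 hc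
  clear hc
  induction h with
  | final c hF => exact ⟨fun _ => .final _ hF, fun l θ hc _ => .final _ hc.2.1 hF⟩
  | universal c hU hall ih =>
    refine ⟨fun hc => .universal _ hU fun d hd => ?_, fun l θ hc hθ =>
      .universal _ hc.2.1 hU fun d hd => hahead c d l θ hc hθ hd (ih d hd)⟩
    have hd' := hd.congr_tape hlen.symm hc.2.1 fun j hj hjk => (hagree c hc j hj hjk).symm
    exact hnext c d hc hd' (ih d hd')
  | existential c d hF hU hd hacc ih =>
    exact ⟨fun hc => .existential _ d hF hU (hd.congr_tape hlen hc.2.1 (hagree c hc))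
      (hnext c d hc hd ih), fun l θ hc hθ =>
      .existential _ d hc.2.1 hF hU hd (hahead c d l θ hc hθ hd ih)⟩

end WeakPA

/-! ### Words with many possible targets -/

section Tape

variable {D : Type*} {u u' v v' : List D} {p : ℕ}

theorem tapeAt_append_left (hp : p < u.length + 1) :
    tapeAt (u ++ v) p = tapeAt (u ++ v') p := by
  cases p with
  | zero => rfl
  | succ p =>
    have h : p < u.length := by omega
    simp [tapeAt, List.getElem?_append_left h]

theorem tapeAt_append_right (hu : u.length = u'.length) (hp : u.length + 1 ≤ p) :
    tapeAt (u ++ v) p = tapeAt (u' ++ v) p := by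
  cases p with
  | zero => omega
  | succ p =>
    have h : u.length ≤ p := by omega
    simp [tapeAt, List.getElem?_append_right h, List.getElem?_append_right (hu ▸ h), hu]

theorem tapeAt_eq_letter_iff {d : D} : tapeAt v (p + 1) = .letter d ↔ v[p]? = some d := by
  simp only [tapeAt]
  cases v[p]? <;> simp

end Tape

/-- The word `a r 0 · a (r+1) 0 · a r 1 · a (r+1) 1 ⋯ a r (N-1) · a (r+1) (N-1)`. -/
def region {D : Type*} (a : ℕ → ℕ → D) (N r : ℕ) : List D :=
  (List.range N).flatMap fun x => [a r x, a (r + 1) x]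

/-- The concatenation of the words `region a N r, …, region a N (r + m - 1)`. -/
def regions {D : Type*} (a : ℕ → ℕ → D) (N : ℕ) : ℕ → ℕ → List D
  | 0, _ => []
  | m + 1, r => region a N r ++ regions a N m (r + 1)

/-- A word that belongs to `reachPlus D (k + 1)` if and only if `s = t`: starting from `a 1 s`,
the jumps lead through `a 2 s, …, a k s`, each in the next region. -/
def pathWord {D : Type*} (a : ℕ → ℕ → D) (N k s t : ℕ) : List D :=
  [a 0 0, a 1 s] ++ (regions a N (k - 1) 1 ++ [a k t, a (k + 1) 0])

section PathWord

variable {D : Type*} {a : ℕ → ℕ → D} {N k m n r s t : ℕ} {d : D}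

theorem length_region : (region a N r).length = 2 * N := by
  simp [region, List.length_flatMap, mul_comm]

theorem length_regions : (regions a N m r).length = 2 * N * m := by
  induction m generalizing r with
  | zero => rfl
  | succ m ih =>
    rw [regions, List.length_append, length_region, ih]
    ring

theorem regions_add : regions a N (m + n) r = regions a N m r ++ regions a N n (r + m) := by
  induction m generalizing r with
  | zero => simp [regions]
  | succ m ih =>
    rw [Nat.succ_add, regions, ih, regions, List.append_assoc, Nat.add_right_comm r 1 m,
      ← Nat.add_assoc r m 1]

theorem exists_of_mem_region (h : d ∈ region a N r) :
    ∃ r' x, d = a r' x ∧ r ≤ r' ∧ r' ≤ r + 1 := by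
  simp only [region, List.mem_flatMap, List.mem_range, List.mem_cons, List.not_mem_nil,
    or_false] at h
  obtain ⟨x, -, rfl | rfl⟩ := h
  · exact ⟨r, x, rfl, by omega, by omega⟩
  · exact ⟨r + 1, x, rfl, by omega, by omega⟩

theorem exists_of_mem_regions (h : d ∈ regions a N m r) :
    ∃ r' x, d = a r' x ∧ r ≤ r' ∧ r' ≤ r + m := by
  induction m generalizing r with
  | zero => simp [regions] at h
  | succ m ih =>
    rw [regions, List.mem_append] at h
    rcases h with h | h
    · obtain ⟨r', x, hd, h1, h2⟩ := exists_of_mem_region h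
      exact ⟨r', x, hd, h1, by omega⟩
    · obtain ⟨r', x, hd, h1, h2⟩ := ih h
      exact ⟨r', x, hd, by omega, by omega⟩

theorem region_eq_append (ha : ∀ r x r' x', a r x = a r' x' → r = r' ∧ x = x') (hs : s < N) :
    ∃ y y', region a N r = y ++ a r s :: a (r + 1) s :: y' ∧ a r s ∉ y ∧ a (r + 1) s ∉ y' := by
  obtain ⟨n, rfl⟩ := Nat.exists_eq_add_of_lt hs
  refine ⟨(List.range s).flatMap fun x => [a r x, a (r + 1) x],
    ((List.range n).map (s + 1 + ·)).flatMap fun x => [a r x, a (r + 1) x], ?_, ?_, ?_⟩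
  · rw [region, Nat.add_right_comm, List.range_add, List.flatMap_append, List.range_succ,
      List.flatMap_append]
    simp
  · simp only [List.mem_flatMap, List.mem_range, List.mem_cons, List.not_mem_nil, or_false]
    rintro ⟨x, hx, h | h⟩ <;> have := ha _ _ _ _ h <;> omega
  · simp only [List.mem_flatMap, List.mem_map, List.mem_range, List.mem_cons, List.not_mem_nil,
      or_false]
    rintro ⟨x, ⟨i, hi, rfl⟩, h | h⟩ <;> have := ha _ _ _ _ h <;> omega

theorem hopPath_regions_iff (ha : ∀ r x r' x', a r x = a r' x' → r = r' ∧ x = x')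
    (hs : s < N) {y : List D} (hy : a r s ∉ y) :
    HopPath (m + 1) (a r s :: (y ++ (regions a N m r ++ [a (r + m) t, a (r + m + 1) 0]))) ↔
      s = t := by
  rw [HopPath.append_iff hy]
  induction m generalizing r y with
  | zero =>
    constructor
    · intro h
      have h' := h.mem_of_succ
      simp only [regions, List.nil_append, List.mem_cons, List.not_mem_nil, or_false] at h'
      rcases h' with h' | h' <;> have := ha _ _ _ _ h' <;> omega
    · rintro rfl
      refine HopPath.cons_self_iff.2 ⟨_, _, rfl, fun h => ?_, .single _⟩
      have := ha _ _ _ _ h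
      omega
  | succ m ih =>
    obtain ⟨y₁, y₂, hreg, hy₁, hy₂⟩ := region_eq_append (r := r) ha hs
    rw [regions, hreg, List.append_assoc, List.append_assoc, HopPath.append_iff hy₁,
      List.cons_append, HopPath.cons_self_iff, ← ih hy₂, ← HopPath.append_iff hy₂,
      show r + (m + 1) = r + 1 + m by omega]
    constructor
    · rintro ⟨c', v', h, -, hp⟩
      rw [← h] at hp
      exact hp
    · intro hp
      refine ⟨_, _, rfl, fun h => ?_, hp⟩
      have := ha _ _ _ _ h
      omega

theorem pathWord_mem_iff (ha : ∀ r x r' x', a r x = a r' x' → r = r' ∧ x = x')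
    (hk : 1 ≤ k) (hs : s < N) : pathWord a N k s t ∈ reachPlus D (k + 1) ↔ s = t := by
  obtain ⟨m, rfl⟩ : ∃ m, k = m + 1 := ⟨k - 1, by omega⟩
  rw [mem_reachPlus_iff, ← hopPath_regions_iff (m := m) (r := 1) (y := []) ha hs (by simp),
    Nat.add_comm 1 m]
  constructor
  · rintro ⟨c₀, c₁, v, hv, -, h⟩
    simp only [pathWord, List.cons_append, List.nil_append, List.cons.injEq] at hv
    obtain ⟨-, rfl, rfl⟩ := hv
    exact h
  · intro h
    refine ⟨_, _, _, rfl, fun h => ?_, h⟩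
    have := ha _ _ _ _ h
    omega

/-- Cutting `pathWord` at the threshold of pebble `l`, before region `k - l + 1`. -/
theorem pathWord_eq_append {l : ℕ} (h1 : 1 ≤ l) (hl : l ≤ k) : pathWord a N k s t =
    ([a 0 0, a 1 s] ++ regions a N (k - l) 1) ++
      (regions a N (l - 1) (k - l + 1) ++ [a k t, a (k + 1) 0]) := by
  rw [pathWord, show k - 1 = (k - l) + (l - 1) by omega, regions_add, Nat.add_comm 1 (k - l)]
  simp

theorem length_pathWord_prefix {l : ℕ} :
    ([a 0 0, a 1 s] ++ regions a N (k - l) 1).length = 2 * N * (k - l) + 2 := by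
  simp [length_regions]

theorem hidden_pathWord (ha : ∀ r x r' x', a r x = a r' x' → r = r' ∧ x = x') {l l' p : ℕ}
    (h1 : 1 ≤ l) (hl : l < l') (hl' : l' ≤ k) (hp : p < 2 * N * (k - l') + 3) :
    WeakPA.Hidden (pathWord a N k s t) (2 * N * (k - l) + 3) p := by
  have hle : 2 * N * (k - l') ≤ 2 * N * (k - l) := Nat.mul_le_mul_left _ (by omega)
  refine ⟨by omega, fun q hq => ?_⟩
  have hdisj : ∀ d ∈ [a 0 0, a 1 s] ++ regions a N (k - l') 1,
      d ∉ regions a N (l - 1) (k - l + 1) ++ [a k t, a (k + 1) 0] := by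
    intro d hd hd'
    have hd1 : ∃ r x, d = a r x ∧ r ≤ k - l' + 1 := by
      simp only [List.mem_append, List.mem_cons, List.not_mem_nil, or_false] at hd
      rcases hd with (rfl | rfl) | hd
      · exact ⟨0, 0, rfl, by omega⟩
      · exact ⟨1, s, rfl, by omega⟩
      · obtain ⟨r, x, h, h2, h3⟩ := exists_of_mem_regions hd
        exact ⟨r, x, h, by omega⟩
    have hd2 : ∃ r x, d = a r x ∧ k - l + 1 ≤ r := by
      simp only [List.mem_append, List.mem_cons, List.not_mem_nil, or_false] at hd'
      rcases hd' with hd' | (rfl | rfl)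
      · obtain ⟨r, x, h, h2, h3⟩ := exists_of_mem_regions hd'
        exact ⟨r, x, h, h2⟩
      · exact ⟨k, t, rfl, by omega⟩
      · exact ⟨k + 1, 0, rfl, by omega⟩
    obtain ⟨r, x, rfl, hr⟩ := hd1
    obtain ⟨r', x', h, hr'⟩ := hd2
    have := ha _ _ _ _ h
    omega
  cases p with
  | zero => exact WeakPA.tapeAt_ne_leftEnd (by omega)
  | succ p =>
    obtain ⟨q, rfl⟩ : ∃ q', q = q' + 1 := ⟨q - 1, by omega⟩
    have hp' : p < ([a 0 0, a 1 s] ++ regions a N (k - l') 1).length := by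
      rw [length_pathWord_prefix]
      omega
    have h2 : (pathWord a N k s t)[p]? =
        some ([a 0 0, a 1 s] ++ regions a N (k - l') 1)[p] := by
      rw [pathWord_eq_append (h1.trans hl.le) hl', List.getElem?_append_left hp',
        List.getElem?_eq_getElem hp']
    rw [tapeAt_eq_letter_iff.2 h2]
    intro h3
    have h4 := tapeAt_eq_letter_iff.1 h3.symm
    rw [pathWord_eq_append h1 (hl.le.trans hl'), List.getElem?_append_right
      (by rw [length_pathWord_prefix]; omega)] at h4
    exact hdisj _ (List.getElem_mem hp') (List.mem_of_getElem? h4)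

theorem reachPlus_notMem_wPA [Infinite D] (hk : 1 ≤ k) : reachPlus D (k + 1) ∉ wPA D k := by
  rintro ⟨A, hA⟩
  have := A.finite_state
  let e := Infinite.natEmbedding D
  let a : ℕ → ℕ → D := fun r x => e (Nat.pair r x)
  have ha : ∀ r x r' x', a r x = a r' x' → r = r' ∧ x = x' := fun r x r' x' h =>
    Nat.pair_eq_pair.1 (e.injective h)
  -- More indices than there are possible behaviours of the solo computations.
  obtain ⟨N, hN⟩ : ∃ N, Nat.card (Fin k → Set A.State → A.State → Prop) < N :=
    ⟨_, Nat.lt_succ_self _⟩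
  let B : ℕ → ℕ := fun l => 2 * N * (k - l) + 3
  let W : ℕ → ℕ → List D := pathWord a N k
  let G : Fin N → (Fin k → Set A.State → A.State → Prop) := fun t l S q =>
    A.AcceptsUntil (W t t) (l + 1) S (WeakPA.soloConfig (l + 1) (B (l + 1)) q)
  obtain ⟨t, t', hne, hG⟩ : ∃ t t', t ≠ t' ∧ G t = G t' := by
    by_contra! h
    have hinj : Function.Injective G := fun t t' => not_imp_not.1 (h t t')
    have := Nat.card_le_card_of_injective G hinj
    rw [Nat.card_fin] at this
    omega
  have hlen : ∀ s s' t t', (W s t).length = (W s' t').length := by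
    simp [W, pathWord]
  have hacc : W t t ∈ A.language D := hA ▸ (pathWord_mem_iff ha hk t.2).2 rfl
  have hrej : W t t' ∉ A.language D := hA ▸ fun h =>
    hne (Fin.ext ((pathWord_mem_iff ha hk t.2).1 h))
  refine hrej (WeakPA.leadsToAcceptance_transfer (B := B) (hlen _ _ _ _) (fun l => by simp [B])
    (fun l l' hl => ?_) (fun p hp => ?_) (fun l l' p => hidden_pathWord ha)
    (fun l l' p => hidden_pathWord ha) (fun l h1 hl S q h => ?_)
    ⟨hk, le_rfl, fun j _ _ => by simp [B, WeakPA.initConfig]⟩ hacc)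
  · simp only [B]
    have : 2 * N * (k - l') ≤ 2 * N * (k - l) := Nat.mul_le_mul_left _ (by omega)
    omega
  · simp only [W]
    rw [pathWord_eq_append le_rfl hk, pathWord_eq_append le_rfl hk]
    have hp' : p < ([a 0 0, a 1 ↑t] ++ regions a N (k - 1) 1).length + 1 := by
      rw [length_pathWord_prefix]
      exact hp
    simp only [Nat.sub_self, regions, List.nil_append]
    exact tapeAt_append_left hp'
  · have h' : A.AcceptsUntil (W t' t') l S (WeakPA.soloConfig l (B l) q) := by
      have h2 := congrFun (congrFun (congrFun hG ⟨l - 1, by omega⟩) S) q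
      simp only [G, Nat.sub_add_cancel h1] at h2
      exact h2 ▸ h
    -- The solo computations do not see the letter `a 1 s`, the only difference of the words.
    refine WeakPA.Tied.acceptsUntil (hlen _ _ _ _) (b := B l) (fun p hp => ?_)
      ⟨rfl, rfl, fun j hj hjl => ⟨rfl, ?_⟩, fun j hj hjk => ?_⟩ h'
    · simp only [W]
      rw [pathWord_eq_append h1 hl, pathWord_eq_append h1 hl]
      refine tapeAt_append_right (by simp [length_regions]) ?_
      rw [length_pathWord_prefix]
      exact hp
    · simp [WeakPA.soloConfig, hjl]
    · have h0 : ∀ w : List D, WeakPA.Hidden w (B l) 0 := fun w =>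
        WeakPA.hidden_zero (by simp [B])
      simpa [WeakPA.soloConfig, hj.not_ge] using ⟨h0 _, h0 _⟩

end PathWord

theorem lemmal {D : Type*} [Infinite D] (k : ℕ) (hk : 1 ≤ k) :
    (2 ≤ k → reachPlus D k ∈ wPA D k) ∧ reachPlus D (k + 1) ∉ wPA D k :=
  ⟨fun h2 => ⟨reachAutomaton k, ReachState.language_reachAutomaton h2⟩, reachPlus_notMem_wPA hk⟩
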